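/- Let $d\ge 1$, $k$, $\ell$ be integers with $2k>d$ and $\ell>2k-d+1$, let $\varepsilon>2k/\ell$, and let $K,C_{sg}>0$. Let $\phi$ be the surface spline on $\mathbb{R}^d$, normalized so that $\Delta^k\phi=\delta_0$: $$\phi(x)=\frac{(-1)^{d/2+1}\,2}{4^k\pi^{d/2}(k-1)!\,(k-d/2)!}\,|x|^{2k-d}\log|x|\ \ (d\text{ even}),\qquad \phi(x)=\frac{(-1)^k\,\Gamma(d/2-k)}{4^k\pi^{d/2}(k-1)!}\,|x|^{2k-d}\ \ (d\text{ odd}),$$ with $\phi(0)=0$. There is a constant $C>0$, depending only on $d,k,\ell,\varepsilon,K,C_{sg}$, such that the following holds. Let $\Xi\subset\mathbb{R}^d$ be a set of centers and let $\rho:\mathbb{R}^d\to(0,\infty)$ be a local density for $\Xi$ of precision $\ell$, i.e. there is a local polynomial reproduction $a:\Xi\times\mathbb{R}^d\to\mathbb{R}$ such that for all $\alpha\in\mathbb{R}^d$: - (Support) $a(\xi,\alpha)=0$ whenever $\xi\in\Xi$ and $|\xi-\alpha|>\rho(\alpha)$; - (Precision) $\sum_{\xi\in\Xi}a(\xi,\alpha)p(\xi)=p(\alpha)$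 for every real polynomial $p$ in $d$ variables of total degree less than $\ell$; - (Stability) $\sum_{\xi\in\Xi}|a(\xi,\alpha)|<K$. Suppose that for each $x$ the function $\alpha\mapsto\sum_{\xi\in\Xi}a(\xi,\alpha)\phi(x-\xi)$ is Lebesgue measurable (which is automatic if $\Xi$ is countable and every $a(\xi,\cdot)$ is measurable), and that $\rho$ exhibits $1-\varepsilon$ slow growth: $$\rho(\alpha)\le C_{sg}\,\rho(x)\left(1+\frac{|x-\alpha|}{\rho(x)}\right)^{1-\varepsilon}\qquad\text{for all }x,\alpha\in\mathbb{R}^d.$$ Then for every compactly supported $f\in C^{2k}(\mathbb{R}^d)$ and every $x\in\mathbb{R}^d$, the sums and the integral in $$T_\Xi f(x):=\int_{\mathbb{R}^d}\Delta^kf(\alpha)\sum_{\xi\in\Xi}a(\xi,\alpha)\,\phi(x-\xi)\,d\alpha$$ converge absolutely, and $$|f(x)-T_\Xi f(x)|\le C\,\rho(x)^{2k}\,\|\Delta^kf\|_\infty .$$ -/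

import Mathlib

/-- The space `ℝ^d` with its Euclidean norm. -/
abbrev RSpace (d : ℕ) : Type := EuclideanSpace ℝ (Fin d)

/-- The surface spline `φ` on `ℝ^d` (for `2 * k > d`), normalized to be a fundamental solution of the
`k`-fold Laplacian `Δ^k`:
* `φ x = (-1)^(d/2+1) * 2 / (4^k π^(d/2) (k-1)! (k-d/2)!) * |x|^(2k-d) * log |x|` for even `d`;
* `φ x = (-1)^k * Γ(d/2-k) / (4^k π^(d/2) (k-1)!) * |x|^(2k-d)` for odd `d`. -/
noncomputable def surfaceSpline (d k : ℕ) (x : RSpace d) : ℝ :=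
  if Even d then
    (-1) ^ (d / 2 + 1) * 2 /
        (4 ^ k * Real.pi ^ (d / 2) * (Nat.factorial (k - 1) : ℝ) *
          (Nat.factorial (k - d / 2) : ℝ)) *
      (‖x‖ ^ (2 * k - d) * Real.log ‖x‖)
  else
    (-1) ^ k * Real.Gamma ((d : ℝ) / 2 - (k : ℝ)) /
        (4 ^ k * Real.pi ^ ((d : ℝ) / 2) * (Nat.factorial (k - 1) : ℝ)) *
      ‖x‖ ^ (2 * k - d)

/-- `ρ : ℝ^d → (0, ∞)` is a local density for the set of centers `Ξ`, with associated `K`-stable local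
polynomial reproduction `a : Ξ × ℝ^d → ℝ` of order `ℓ`: all polynomials of total degree less than `ℓ`
are reproduced. -/
structure IsLocalDensity {d : ℕ} (Ξ : Set (RSpace d)) (ρ : RSpace d → ℝ)
    (a : Ξ → RSpace d → ℝ) (ℓ : ℕ) (K : ℝ) : Prop where
  pos : ∀ α, 0 < ρ α
  support : ∀ (ξ : Ξ) (α : RSpace d), ρ α < ‖(ξ : RSpace d) - α‖ → a ξ α = 0
  precision : ∀ p : MvPolynomial (Fin d) ℝ, p.totalDegree < ℓ → ∀ α : RSpace d,
    HasSum (fun ξ : Ξ => a ξ α * MvPolynomial.eval (fun i => (ξ : RSpace d) i) p)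
      (MvPolynomial.eval (fun i => α i) p)
  summable : ∀ α : RSpace d, Summable (fun ξ : Ξ => |a ξ α|)
  stability : ∀ α : RSpace d, ∑' ξ : Ξ, |a ξ α| < K

/-- `ρ` exhibits `1 - ε` slow growth with constant `Csg`. -/
def SlowGrowth {d : ℕ} (ρ : RSpace d → ℝ) (ε Csg : ℝ) : Prop :=
  ∀ x α : RSpace d, ρ α ≤ Csg * ρ x * (1 + ‖x - α‖ / ρ x) ^ (1 - ε)

/-- The `k`-fold Laplacian `Δ^k f`. -/
noncomputable def iteratedLaplacian {d : ℕ} (k : ℕ) (f : RSpace d → ℝ) : RSpace d → ℝ :=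
  (fun g : RSpace d → ℝ => Laplacian.laplacian g)^[k] f

/-- The local combination `∑ ξ, a(ξ, α) φ(x - ξ)` of shifts of the surface spline. -/
noncomputable def splineKernel {d : ℕ} (k : ℕ) {Ξ : Set (RSpace d)} (a : Ξ → RSpace d → ℝ)
    (x α : RSpace d) : ℝ :=
  ∑' ξ : Ξ, a ξ α * surfaceSpline d k (x - ξ)

/-- The approximant `T_Ξ f (x) = ∫ Δ^k f(α) ∑ ξ, a(ξ, α) φ(x - ξ) dα`. -/
noncomputable def splineApproximant {d : ℕ} (k : ℕ) {Ξ : Set (RSpace d)} (a : Ξ → RSpace d → ℝ)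
    (f : RSpace d → ℝ) (x : RSpace d) : ℝ :=
  ∫ α, iteratedLaplacian k f α * splineKernel k a x α

/-! The spline `φ` is a fundamental solution, so `f x = ∫ Δ^k f(α) φ(x - α) dα`, and the error is,
up to sign, the integral of `Δ^k f(α)` against `E(x, α) = ∑ a(ξ, α) φ(x - ξ) - φ(x - α)`. It
suffices that `|E| ≤ C ρ(x)^(2k-d) (1 + |x - α|/ρ(x))^(-p)` with `p = d + (εℓ - 2k) > d`:
integrating over `α` supplies the missing `ρ(x)^d`.

The representation (`integral_iteratedLaplacian_mul_surfaceSpline`) comes from Riesz potentials.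
Weakly, `Δ|y|^(p+2) = (p+2)(p+d)|y|^p` for `p > -d`. Iterating `k` times from `p = η - d` produces a
factor `η`, and `η|y|^(η-d)` tends to a multiple of the Dirac mass as `η → 0+`. For odd `d` the
limit is the formula for `|y|^(2k-d)`; for even `d` a second factor `η` appears, and dividing by it
differentiates in the exponent, whence the logarithm.

The bound on `E` (`exists_abs_splineKernel_sub_le`) rests on homogeneity: dilating `φ` adds at most
a polynomial of degree `2k - d < ℓ`, which is reproduced, so `E` scales like `R^(2k-d)`. For `α`
near `x`, rescale by `ρ(x)` and bound `φ` on a ball. For `α` far away, rescale by `|x - α|`: the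
Taylor polynomial of degree less than `ℓ` at a unit vector is reproduced, leaving `(ρ(α)/|x -
α|)^ℓ`, which slow growth turns into decay of order `εℓ`. -/

open MeasureTheory Filter Topology Laplacian

/-! ### The Laplacian in coordinates -/

/-- The Laplacian is the sum of the second partial derivatives. -/
lemma laplacian_eq_sum_fderiv {d : ℕ} {f : RSpace d → ℝ} (hf : ContDiff ℝ 2 f) (y : RSpace d) :
    Δ f y = ∑ i, fderiv ℝ (fun z => fderiv ℝ f z (EuclideanSpace.single i 1)) y
      (EuclideanSpace.single i 1) := by
  rw [InnerProductSpace.laplacian_eq_iteratedFDeriv_orthonormalBasis f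
    (EuclideanSpace.basisFun (Fin d) ℝ)]
  refine Finset.sum_congr rfl fun i _ => ?_
  have h : DifferentiableAt ℝ (fderiv ℝ f) y :=
    ((hf.fderiv_right (m := 1) (by norm_num)).differentiable (by norm_num)) y
  rw [iteratedFDeriv_two_apply, fderiv_clm_apply h (by fun_prop)]
  simp

lemma ContDiff.laplacian_rspace {d n : ℕ} {f : RSpace d → ℝ}
    (hf : ContDiff ℝ (n + 2 : ℕ) f) : ContDiff ℝ n (Δ f) := by
  rw [InnerProductSpace.laplacian_eq_iteratedFDeriv_orthonormalBasis f
    (EuclideanSpace.basisFun (Fin d) ℝ)]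
  refine ContDiff.sum fun i _ => ?_
  have h := hf.iteratedFDeriv_right (m := n) (i := 2) (by norm_cast)
  exact (ContinuousMultilinearMap.apply ℝ (fun _ : Fin 2 => RSpace d) ℝ _).contDiff.comp h

lemma HasCompactSupport.laplacian_rspace {d : ℕ} {f : RSpace d → ℝ}
    (hf : HasCompactSupport f) : HasCompactSupport (Δ f) := by
  refine (hf.iteratedFDeriv (𝕜 := ℝ) 2).mono' fun x hx => subset_tsupport _ ?_
  rw [Function.mem_support] at hx ⊢
  contrapose! hx
  rw [InnerProductSpace.laplacian_eq_iteratedFDeriv_orthonormalBasis f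
    (EuclideanSpace.basisFun (Fin d) ℝ)]
  simp [hx]

lemma iteratedLaplacian_succ {d k : ℕ} (f : RSpace d → ℝ) :
    iteratedLaplacian (k + 1) f = iteratedLaplacian k (Δ f) := rfl

lemma iteratedLaplacian_regular {d : ℕ} (k : ℕ) {f : RSpace d → ℝ}
    (hf : ContDiff ℝ (2 * k : ℕ) f) (hc : HasCompactSupport f) :
    Continuous (iteratedLaplacian k f) ∧ HasCompactSupport (iteratedLaplacian k f) := by
  induction k generalizing f with
  | zero => exact ⟨hf.continuous, hc⟩
  | succ k ih =>
    rw [iteratedLaplacian_succ]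
    exact ih (ContDiff.laplacian_rspace hf) hc.laplacian_rspace

/-! ### Integration by parts -/

lemma integral_fderiv_mul_eq {d : ℕ} {f g : RSpace d → ℝ} (hf : ContDiff ℝ 1 f)
    (hc : HasCompactSupport f) (hg : ContDiff ℝ 1 g) (v : RSpace d) :
    ∫ y, fderiv ℝ f y v * g y = -∫ y, f y * fderiv ℝ g y v := by
  have hf' : Continuous fun y => fderiv ℝ f y v :=
    (hf.continuous_fderiv (by norm_num)).clm_apply continuous_const
  have hg' : Continuous fun y => fderiv ℝ g y v :=
    (hg.continuous_fderiv (by norm_num)).clm_apply continuous_const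
  have h := integral_mul_fderiv_eq_neg_fderiv_mul_of_integrable (μ := volume) (f := f) (g := g)
    (v := v) ((hf'.mul hg.continuous).integrable_of_hasCompactSupport
      ((hc.fderiv_apply (𝕜 := ℝ) v).mul_right))
    ((hf.continuous.mul hg').integrable_of_hasCompactSupport hc.mul_right)
    ((hf.continuous.mul hg.continuous).integrable_of_hasCompactSupport hc.mul_right)
    (fun x _ => hf.differentiable (by norm_num) x) (fun x _ => hg.differentiable (by norm_num) x)
  linarith

lemma contDiff_norm_sub_sq_add_rpow {d : ℕ} (x : RSpace d) {τ : ℝ} (hτ : 0 < τ) (s : ℝ)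
    {n : WithTop ℕ∞} : ContDiff ℝ n fun y : RSpace d => (‖y - x‖ ^ 2 + τ) ^ s := by
  refine ContDiff.rpow_const_of_ne ?_ fun y => by positivity
  exact ((contDiff_id.sub contDiff_const).norm_sq ℝ).add contDiff_const

lemma fderiv_norm_sub_sq_add_rpow {d : ℕ} (x : RSpace d) {τ : ℝ} (hτ : 0 < τ) (s : ℝ)
    (y : RSpace d) (i : Fin d) :
    fderiv ℝ (fun y : RSpace d => (‖y - x‖ ^ 2 + τ) ^ s) y (EuclideanSpace.single i 1) =
      2 * s * ((y i - x i) * (‖y - x‖ ^ 2 + τ) ^ (s - 1)) := by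
  have h0 : ‖y - x‖ ^ 2 + τ ≠ 0 := by positivity
  have h1 : HasFDerivAt (fun y : RSpace d => ‖y - x‖ ^ 2 + τ) (2 • innerSL ℝ (y - x)) y := by
    have := ((hasFDerivAt_id y).sub_const x).norm_sq.add_const τ
    simpa using this
  have h2 := h1.rpow_const (p := s) (Or.inl h0)
  rw [h2.fderiv]
  simp [EuclideanSpace.inner_single_right]
  ring

/-- Two integrations by parts move the Laplacian onto the smooth function `(r² + τ)^s`. Writing `r²
= (r² + τ) - τ` isolates a term that disappears as `τ → 0`. -/
lemma integral_laplacian_mul_rpow_smoothed {d : ℕ} {f : RSpace d → ℝ} (hf : ContDiff ℝ 2 f)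
    (hc : HasCompactSupport f) (x : RSpace d) {τ : ℝ} (hτ : 0 < τ) (s : ℝ) :
    ∫ y, Δ f y * (‖y - x‖ ^ 2 + τ) ^ s =
      2 * s * (d + 2 * s - 2) * (∫ y, f y * (‖y - x‖ ^ 2 + τ) ^ (s - 1)) -
        4 * s * (s - 1) * ∫ y, f y * (τ * (‖y - x‖ ^ 2 + τ) ^ (s - 2)) := by
  set q : ℝ → RSpace d → ℝ := fun s y => (‖y - x‖ ^ 2 + τ) ^ s with hq
  have hqd : ∀ s, ContDiff ℝ 2 (q s) := fun s => contDiff_norm_sub_sq_add_rpow x hτ s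
  have hqc : ∀ s, Continuous (q s) := fun s => (hqd s).continuous
  have hf1 : ∀ i : Fin d, ContDiff ℝ 1 fun z => fderiv ℝ f z (EuclideanSpace.single i 1) :=
    fun i => (hf.fderiv_right (m := 1) (by norm_num)).clm_apply contDiff_const
  have hcoord : ∀ i : Fin d, ContDiff ℝ 1 fun y : RSpace d => y i - x i := fun i =>
    (EuclideanSpace.proj (𝕜 := ℝ) i).contDiff.sub contDiff_const
  have hI : ∀ g : RSpace d → ℝ, Continuous g → Integrable fun y => f y * g y := fun g hg =>
    (hf.continuous.mul hg).integrable_of_hasCompactSupport hc.mul_right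
  have hsq : ∀ (i : Fin d) (s : ℝ), Continuous fun y : RSpace d => (y i - x i) ^ 2 * q s y :=
    fun i s => ((hcoord i).continuous.pow 2).mul (hqc s)
  have key : ∀ i : Fin d,
      ∫ y, fderiv ℝ (fun z => fderiv ℝ f z (EuclideanSpace.single i 1)) y
        (EuclideanSpace.single i 1) * q s y =
      2 * s * (∫ y, f y * q (s - 1) y) +
        4 * s * (s - 1) * ∫ y, f y * ((y i - x i) ^ 2 * q (s - 2) y) := by
    intro i
    rw [integral_fderiv_mul_eq (hf1 i) (hc.fderiv_apply (𝕜 := ℝ) _)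
      ((hqd s).of_le (by norm_num))]
    have e1 : ∀ y, fderiv ℝ f y (EuclideanSpace.single i 1) *
        fderiv ℝ (q s) y (EuclideanSpace.single i 1) =
        2 * s * (fderiv ℝ f y (EuclideanSpace.single i 1) * ((y i - x i) * q (s - 1) y)) := by
      intro y
      rw [fderiv_norm_sub_sq_add_rpow x hτ s y i]
      ring
    simp_rw [e1]
    have hG : ContDiff ℝ 1 fun y : RSpace d => (y i - x i) * q (s - 1) y :=
      (hcoord i).mul ((hqd (s - 1)).of_le (by norm_num))
    rw [integral_const_mul, integral_fderiv_mul_eq (hf.of_le (by norm_num)) hc hG]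
    have e2 : ∀ y, f y * fderiv ℝ (fun y : RSpace d => (y i - x i) * q (s - 1) y) y
        (EuclideanSpace.single i 1) =
        f y * q (s - 1) y + 2 * (s - 1) * (f y * ((y i - x i) ^ 2 * q (s - 2) y)) := by
      intro y
      have h1 : HasFDerivAt (fun y : RSpace d => y i - x i)
          (EuclideanSpace.proj (𝕜 := ℝ) i : RSpace d →L[ℝ] ℝ) y :=
        (EuclideanSpace.proj (𝕜 := ℝ) i : RSpace d →L[ℝ] ℝ).hasFDerivAt.sub_const _
      have h2 := (((hqd (s - 1)).differentiable (by norm_num)) y).hasFDerivAt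
      have h4 := (h1.fun_mul h2).fderiv
      rw [h4]
      have h3 := fderiv_norm_sub_sq_add_rpow x hτ (s - 1) y i
      rw [show s - 1 - 1 = s - 2 by ring] at h3
      simp only [add_apply, smul_apply, smul_eq_mul]
      rw [h3]
      simp [hq]
      ring
    simp_rw [e2]
    rw [integral_add (hI _ (hqc _)) ((hI _ (hsq i _)).const_mul _),
      integral_const_mul]
    ring
  have hΔ : ∀ y, Δ f y * q s y = ∑ i, fderiv ℝ (fun z => fderiv ℝ f z (EuclideanSpace.single i 1)) y
        (EuclideanSpace.single i 1) * q s y := by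
    intro y
    rw [laplacian_eq_sum_fderiv hf, Finset.sum_mul]
  change ∫ y, Δ f y * q s y = _
  simp_rw [hΔ]
  rw [integral_finsetSum]
  · simp_rw [key]
    rw [Finset.sum_add_distrib, Finset.sum_const, ← Finset.mul_sum, ← integral_finsetSum]
    · have e3 : ∀ y, ∑ i, f y * ((y i - x i) ^ 2 * q (s - 2) y) =
          f y * q (s - 1) y - f y * (τ * q (s - 2) y) := by
        intro y
        have h0 : (0 : ℝ) < ‖y - x‖ ^ 2 + τ := by positivity
        have hs : ∑ i, (y i - x i) ^ 2 = ‖y - x‖ ^ 2 := by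
          rw [EuclideanSpace.norm_sq_eq]; simp
        have h1 : q (s - 1) y = (‖y - x‖ ^ 2 + τ) * q (s - 2) y := by
          simp only [hq]
          rw [show s - 1 = 1 + (s - 2) by ring, Real.rpow_add h0, Real.rpow_one]
        rw [← Finset.mul_sum, ← Finset.sum_mul, hs, h1]
        ring
      simp_rw [e3]
      rw [integral_sub (hI _ (hqc _)) (hI (fun y => τ * q (s - 2) y) (continuous_const.mul (hqc _)))]
      simp [hq]
      ring
    · exact fun i _ => hI _ (hsq i _)
  · intro i _
    refine Continuous.integrable_of_hasCompactSupport ?_ ?_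
    · exact (((hf1 i).continuous_fderiv (by norm_num)).clm_apply continuous_const).mul (hqc s)
    · exact ((hc.fderiv_apply (𝕜 := ℝ) _).fderiv_apply (𝕜 := ℝ) _).mul_right

/-! ### Removing the regularization -/

lemma integrable_mul_norm_sub_rpow {d : ℕ} (hd : 0 < d) {g : RSpace d → ℝ} (hg : Continuous g)
    (hc : HasCompactSupport g) (x : RSpace d) {p : ℝ} (hp : -(d : ℝ) < p) :
    Integrable fun y => g y * ‖y - x‖ ^ p := by
  have h1 : LocallyIntegrable (fun y : RSpace d => ‖y‖ ^ p) volume := by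
    refine locallyIntegrable_of_norm_le_rpow (C := 1) (α := -p) (by simpa [Nat.one_le_iff_ne_zero] using hd.ne')
      (by simp; linarith) (ae_of_all _ fun y => ?_)
      (by fun_prop : Measurable fun y : RSpace d => ‖y‖ ^ p).aestronglyMeasurable
    rw [neg_neg, one_mul, Real.norm_of_nonneg (by positivity)]
  have h2 := h1.integrable_smul_left_of_hasCompactSupport (g := fun y => g (y + x))
    (by fun_prop) (hc.comp_homeomorph (Homeomorph.addRight x))
  simpa using h2.comp_sub_right x

lemma ae_norm_sub_pos {d : ℕ} (hd : 0 < d) (x : RSpace d) :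
    ∀ᵐ y : RSpace d, 0 < ‖y - x‖ := by
  have : Nonempty (Fin d) := ⟨⟨0, hd⟩⟩
  filter_upwards [compl_mem_ae_iff.mpr (measure_singleton x)] with y hy
  exact norm_pos_iff.mpr (sub_ne_zero.mpr hy)

/-- A majorant uniform in `τ` for dominated convergence: monotonicity in `τ` selects one summand
according to the sign of `s`. -/
lemma norm_sq_add_rpow_le {r τ : ℝ} (hr : 0 < r) (h0 : 0 < τ) (h1 : τ ≤ 1) (s : ℝ) :
    (r ^ 2 + τ) ^ s ≤ r ^ (2 * s) + (r ^ 2 + 1) ^ s := by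
  have e : r ^ (2 * s) = (r ^ 2) ^ s := by
    rw [Real.rpow_mul hr.le]; norm_cast
  rcases le_total 0 s with hs | hs
  · have : (r ^ 2 + τ) ^ s ≤ (r ^ 2 + 1) ^ s :=
      Real.rpow_le_rpow (by positivity) (by linarith) hs
    have h2 : 0 ≤ r ^ (2 * s) := by positivity
    linarith
  · have : (r ^ 2 + τ) ^ s ≤ (r ^ 2) ^ s :=
      Real.rpow_le_rpow_of_nonpos (by positivity) (by linarith) hs
    have h2 : 0 ≤ (r ^ 2 + 1) ^ s := by positivity
    linarith

lemma integrable_smoothed_bound {d : ℕ} (hd : 0 < d) {g : RSpace d → ℝ} (hg : Continuous g)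
    (hc : HasCompactSupport g) (x : RSpace d) {s : ℝ} (hs : -(d : ℝ) < 2 * s) :
    Integrable fun y => |g y| * (‖y - x‖ ^ (2 * s) + (‖y - x‖ ^ 2 + 1) ^ s) := by
  have h1 := (integrable_mul_norm_sub_rpow hd hg hc x hs).norm
  have h2 : Integrable fun y => g y * (‖y - x‖ ^ 2 + 1) ^ s :=
    (hg.mul (contDiff_norm_sub_sq_add_rpow x one_pos s (n := 0)).continuous).integrable_of_hasCompactSupport
      hc.mul_right
  refine (h1.add h2.norm).congr (ae_of_all _ fun y => ?_)
  simp only [Pi.add_apply, norm_mul, Real.norm_eq_abs]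
  rw [abs_of_nonneg (by positivity : 0 ≤ ‖y - x‖ ^ (2 * s)),
    abs_of_nonneg (by positivity : 0 ≤ (‖y - x‖ ^ 2 + 1) ^ s)]
  ring

lemma tendsto_integral_smoothed {d : ℕ} (hd : 0 < d) {g : RSpace d → ℝ} (hg : Continuous g)
    (hc : HasCompactSupport g) (x : RSpace d) {s : ℝ} (hs : -(d : ℝ) < 2 * s) :
    Tendsto (fun τ : ℝ => ∫ y, g y * (‖y - x‖ ^ 2 + τ) ^ s) (𝓝[>] 0)
      (𝓝 (∫ y, g y * ‖y - x‖ ^ (2 * s))) := by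
  refine tendsto_integral_filter_of_dominated_convergence _ ?_ ?_
    (integrable_smoothed_bound hd hg hc x hs) ?_
  · filter_upwards [self_mem_nhdsWithin] with τ hτ
    exact (hg.mul (contDiff_norm_sub_sq_add_rpow x hτ s (n := 0)).continuous).aestronglyMeasurable
  · filter_upwards [Ioc_mem_nhdsGT (zero_lt_one' ℝ)] with τ hτ
    filter_upwards [ae_norm_sub_pos hd x] with y hy
    have h0 := hτ.1
    rw [norm_mul, Real.norm_eq_abs, Real.norm_of_nonneg (by positivity)]
    exact mul_le_mul_of_nonneg_left (norm_sq_add_rpow_le hy hτ.1 hτ.2 s) (abs_nonneg _)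
  · filter_upwards [ae_norm_sub_pos hd x] with y hy
    have h1 : Tendsto (fun τ : ℝ => (‖y - x‖ ^ 2 + τ) ^ s) (𝓝 0) (𝓝 ((‖y - x‖ ^ 2 + 0) ^ s)) :=
      (tendsto_const_nhds.add tendsto_id).rpow_const (Or.inl (by positivity))
    have e : ‖y - x‖ ^ (2 * s) = (‖y - x‖ ^ 2 + 0) ^ s := by
      rw [Real.rpow_mul hy.le, add_zero]; norm_cast
    rw [e]
    exact (h1.mono_left nhdsWithin_le_nhds).const_mul _

/-- Since `τ ≤ r² + τ`, the integrand is dominated as for exponent `s - 1`, while it tends to 0 off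
`x`. -/
lemma tendsto_integral_smoothed_error {d : ℕ} (hd : 0 < d) {g : RSpace d → ℝ} (hg : Continuous g)
    (hc : HasCompactSupport g) (x : RSpace d) {s : ℝ} (hs : -(d : ℝ) < 2 * (s - 1)) :
    Tendsto (fun τ : ℝ => ∫ y, g y * (τ * (‖y - x‖ ^ 2 + τ) ^ (s - 2))) (𝓝[>] 0) (𝓝 0) := by
  rw [show 𝓝 (0 : ℝ) = 𝓝 (∫ y : RSpace d, (0 : ℝ)) by simp]
  refine tendsto_integral_filter_of_dominated_convergence _ ?_ ?_
    (integrable_smoothed_bound hd hg hc x hs) ?_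
  · filter_upwards [self_mem_nhdsWithin] with τ hτ
    exact (hg.mul (continuous_const.mul
      (contDiff_norm_sub_sq_add_rpow x hτ _ (n := 0)).continuous)).aestronglyMeasurable
  · filter_upwards [Ioc_mem_nhdsGT (zero_lt_one' ℝ)] with τ hτ
    filter_upwards [ae_norm_sub_pos hd x] with y hy
    have h0 := hτ.1
    rw [norm_mul, Real.norm_eq_abs, Real.norm_of_nonneg (by positivity)]
    refine mul_le_mul_of_nonneg_left (le_trans ?_ (norm_sq_add_rpow_le hy hτ.1 hτ.2 _))
      (abs_nonneg _)
    have h0 : (0 : ℝ) < ‖y - x‖ ^ 2 + τ := by positivity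
    rw [show s - 1 = 1 + (s - 2) by ring, Real.rpow_add h0, Real.rpow_one]
    exact mul_le_mul_of_nonneg_right (by nlinarith [sq_nonneg ‖y - x‖]) (by positivity)
  · filter_upwards [ae_norm_sub_pos hd x] with y hy
    have h1 : Tendsto (fun τ : ℝ => g y * (τ * (‖y - x‖ ^ 2 + τ) ^ (s - 2))) (𝓝 0)
        (𝓝 (g y * (0 * (‖y - x‖ ^ 2 + 0) ^ (s - 2)))) :=
      (tendsto_id.mul ((tendsto_const_nhds.add tendsto_id).rpow_const
        (Or.inl (by positivity)))).const_mul _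
    simpa using h1.mono_left nhdsWithin_le_nhds

lemma integral_laplacian_mul_norm_sub_rpow {d : ℕ} (hd : 0 < d) {f : RSpace d → ℝ}
    (hf : ContDiff ℝ 2 f) (hc : HasCompactSupport f) (x : RSpace d) {p : ℝ}
    (hp : -(d : ℝ) < p) :
    ∫ y, Δ f y * ‖y - x‖ ^ (p + 2) = (p + 2) * (p + d) * ∫ y, f y * ‖y - x‖ ^ p := by
  have hΔc : Continuous (Δ f) := (ContDiff.laplacian_rspace (n := 0) hf).continuous
  have h1 := tendsto_integral_smoothed hd hΔc hc.laplacian_rspace x (s := (p + 2) / 2)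
    (by linarith)
  have h2 := tendsto_integral_smoothed hd hf.continuous hc x (s := (p + 2) / 2 - 1)
    (by linarith)
  have h3 := tendsto_integral_smoothed_error hd hf.continuous hc x (s := (p + 2) / 2)
    (by linarith)
  have h4 := (h2.const_mul (2 * ((p + 2) / 2) * (d + 2 * ((p + 2) / 2) - 2))).sub
    (h3.const_mul (4 * ((p + 2) / 2) * ((p + 2) / 2 - 1)))
  have h5 := tendsto_nhds_unique (h1.congr' (by
    filter_upwards [self_mem_nhdsWithin] with τ hτ
    exact integral_laplacian_mul_rpow_smoothed hf hc x hτ _)) h4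
  rw [show 2 * ((p + 2) / 2) = p + 2 by ring, show 2 * ((p + 2) / 2 - 1) = p by ring] at h5
  rw [h5]
  ring

lemma integral_iteratedLaplacian_mul_norm_sub_rpow {d : ℕ} (hd : 0 < d) (k : ℕ)
    {f : RSpace d → ℝ} (hf : ContDiff ℝ (2 * k : ℕ) f) (hc : HasCompactSupport f) (x : RSpace d)
    {p : ℝ} (hp : -(d : ℝ) < p) :
    ∫ y, iteratedLaplacian k f y * ‖y - x‖ ^ (p + 2 * k) =
      (∏ i ∈ Finset.range k, ((p + 2 * (i + 1)) * (p + 2 * i + d))) *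
        ∫ y, f y * ‖y - x‖ ^ p := by
  induction k generalizing f p with
  | zero => simp [iteratedLaplacian]
  | succ k ih =>
    rw [iteratedLaplacian_succ, Finset.prod_range_succ']
    have h1 := ih (ContDiff.laplacian_rspace hf) hc.laplacian_rspace (p := p + 2) (by linarith)
    rw [integral_laplacian_mul_norm_sub_rpow hd (hf.of_le (by norm_cast; omega)) hc x hp] at h1
    rw [show p + 2 * ((k + 1 : ℕ) : ℝ) = p + 2 + 2 * k by push_cast; ring, h1, ← mul_assoc]
    congr 1
    simp only [CharP.cast_eq_zero, zero_add, mul_one, mul_zero, add_zero]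
    congr 1
    refine Finset.prod_congr rfl fun i _ => ?_
    push_cast
    ring

/-! ### Riesz potentials of vanishing order -/

lemma integral_indicator_ball_norm_rpow {d : ℕ} (hd : 0 < d) {η : ℝ} (hη : 0 < η) :
    ∫ y : RSpace d, (Set.Iio (1 : ℝ)).indicator (fun t => t ^ (η - d)) ‖y‖ =
      d * volume.real (Metric.ball (0 : RSpace d) 1) / η := by
  have : Nonempty (Fin d) := ⟨⟨0, hd⟩⟩
  rw [integral_fun_norm_addHaar volume (fun t => (Set.Iio (1 : ℝ)).indicator (fun t => t ^ (η - d)) t)]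
  have h1 : ∫ t in Set.Ioi (0 : ℝ), t ^ (Module.finrank ℝ (RSpace d) - 1) •
      (Set.Iio (1 : ℝ)).indicator (fun t => t ^ (η - d)) t = 1 / η := by
    have e : ∀ t ∈ Set.Ioi (0 : ℝ), t ^ (Module.finrank ℝ (RSpace d) - 1) •
      (Set.Iio (1 : ℝ)).indicator (fun t => t ^ (η - d)) t =
      (Set.Iio (1 : ℝ)).indicator (fun t => t ^ (η - 1)) t := by
      intro t ht
      by_cases h : t ∈ Set.Iio (1 : ℝ)
      · rw [Set.indicator_of_mem h, Set.indicator_of_mem h, smul_eq_mul, finrank_euclideanSpace_fin,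
          ← Real.rpow_natCast, ← Real.rpow_add ht]
        congr 1
        push_cast [Nat.cast_sub (Nat.succ_le_of_lt hd)]
        ring
      · simp [h]
    rw [setIntegral_congr_fun measurableSet_Ioi e, setIntegral_indicator measurableSet_Iio,
      Set.Ioi_inter_Iio, ← integral_Ioc_eq_integral_Ioo,
      ← intervalIntegral.integral_of_le zero_le_one, integral_rpow (Or.inl (by linarith))]
    simp [hη.ne']
  rw [h1, finrank_euclideanSpace_fin]
  simp
  ring

/-- On the unit ball around `x`, `r^(η-d)` has integral exactly `c / η`. After subtracting `f x`
there, the Lipschitz bound removes the singularity, so the rest stays bounded and the factor `η`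
kills it. -/
lemma tendsto_mul_integral_norm_sub_rpow {d : ℕ} (hd : 0 < d) {f : RSpace d → ℝ}
    (hf : ContDiff ℝ 1 f) (hc : HasCompactSupport f) (x : RSpace d) :
    Tendsto (fun η : ℝ => η * ∫ y, f y * ‖y - x‖ ^ (η - d)) (𝓝[>] 0)
      (𝓝 (d * volume.real (Metric.ball (0 : RSpace d) 1) * f x)) := by
  obtain ⟨L, hL⟩ := ContDiff.lipschitzWith_of_hasCompactSupport hc hf (by norm_num)
  set c : ℝ := d * volume.real (Metric.ball (0 : RSpace d) 1) with hcdef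
  set χ : ℝ → RSpace d → ℝ := fun p y => (Set.Iio (1 : ℝ)).indicator (fun t => t ^ p) ‖y - x‖
    with hχ
  have hχball : ∀ p : ℝ, -(d : ℝ) < p → Integrable (χ p) := by
    intro p hp
    have h1 : IntegrableOn (fun y : RSpace d => ‖y‖ ^ p) (Metric.ball 0 1) := by
      refine integrableOn_ball_of_norm_le_rpow (C := 1) (α := -p)
        (by simpa [Nat.one_le_iff_ne_zero] using hd.ne') (by simp; linarith)
        (ae_of_all _ fun y => ?_)
        (by fun_prop : Measurable fun y : RSpace d => ‖y‖ ^ p).aestronglyMeasurable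
      rw [neg_neg, one_mul, Real.norm_of_nonneg (by positivity)]
    rw [← integrable_indicator_iff measurableSet_ball] at h1
    refine (h1.comp_sub_right x).congr (ae_of_all _ fun y => ?_)
    simp [hχ, Set.indicator]
  have hχint : ∀ η : ℝ, 0 < η → ∫ y, χ (η - d) y = c / η := by
    intro η hη
    rw [← integral_indicator_ball_norm_rpow hd hη,
      ← integral_sub_right_eq_self
        (fun y : RSpace d => (Set.Iio (1 : ℝ)).indicator (fun t => t ^ (η - d)) ‖y‖) x]
  have hint : ∀ p : ℝ, -(d : ℝ) < p → Integrable fun y => f y * ‖y - x‖ ^ p := fun p hp =>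
    integrable_mul_norm_sub_rpow hd hf.continuous hc x hp
  -- A majorant for all `η ≤ 1`: the first term serves `r < 1` via Lipschitz continuity, the second
  -- serves `r ≥ 1`, where the power increases with `η`.
  set H : RSpace d → ℝ := fun y => L * χ (1 - d) y + |f y * ‖y - x‖ ^ (1 - d : ℝ)| with hH
  have hHint : Integrable H :=
    ((hχball _ (by linarith)).const_mul _).add (hint _ (by linarith)).abs
  have hsplit : ∀ η : ℝ, 0 < η → η * ∫ y, f y * ‖y - x‖ ^ (η - d) =
      η * (∫ y, (f y * ‖y - x‖ ^ (η - d) - f x * χ (η - d) y)) + c * f x := by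
    intro η hη
    rw [integral_sub (hint _ (by linarith)) ((hχball _ (by linarith)).const_mul _),
      integral_const_mul, hχint η hη]
    field_simp
    ring
  have hsmall : Tendsto (fun η : ℝ =>
      η * (∫ y, (f y * ‖y - x‖ ^ (η - d) - f x * χ (η - d) y))) (𝓝[>] 0) (𝓝 0) := by
    have h0 : Tendsto (fun η : ℝ => η * ∫ y, H y) (𝓝[>] 0) (𝓝 0) := by
      have : Tendsto (fun η : ℝ => η * ∫ y, H y) (𝓝 0) (𝓝 (0 * ∫ y, H y)) :=
        tendsto_id.mul_const _
      simpa using this.mono_left nhdsWithin_le_nhds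
    refine squeeze_zero_norm' ?_ h0
    filter_upwards [Ioc_mem_nhdsGT (zero_lt_one' ℝ)] with η hη
    rw [norm_mul, Real.norm_of_nonneg hη.1.le]
    refine mul_le_mul_of_nonneg_left ?_ hη.1.le
    refine norm_integral_le_of_norm_le hHint ?_
    filter_upwards [ae_norm_sub_pos hd x] with y hy
    by_cases h : ‖y - x‖ < 1
    · simp only [hχ, hH, Set.indicator, Set.mem_Iio, h, if_true]
      rw [← sub_mul, norm_mul, Real.norm_of_nonneg (by positivity : 0 ≤ ‖y - x‖ ^ (η - d))]
      have h1 : ‖f y - f x‖ ≤ L * ‖y - x‖ := hL.norm_sub_le y x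
      have h2 : ‖y - x‖ * ‖y - x‖ ^ (η - d) ≤ ‖y - x‖ ^ (1 - d : ℝ) := by
        nth_rewrite 1 [← Real.rpow_one ‖y - x‖]
        rw [← Real.rpow_add hy]
        exact Real.rpow_le_rpow_of_exponent_ge hy h.le (by linarith [hη.1])
      calc ‖f y - f x‖ * ‖y - x‖ ^ (η - d) ≤ L * ‖y - x‖ * ‖y - x‖ ^ (η - d) :=
            mul_le_mul_of_nonneg_right h1 (by positivity)
        _ = L * (‖y - x‖ * ‖y - x‖ ^ (η - d)) := by ring
        _ ≤ L * ‖y - x‖ ^ (1 - d : ℝ) := mul_le_mul_of_nonneg_left h2 L.2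
        _ ≤ _ := le_add_of_nonneg_right (abs_nonneg _)
    · simp only [hχ, hH, Set.indicator, Set.mem_Iio, h, if_false, mul_zero, sub_zero, zero_add]
      rw [norm_mul, abs_mul, Real.norm_eq_abs, Real.norm_eq_abs]
      refine mul_le_mul_of_nonneg_left ?_ (abs_nonneg _)
      rw [abs_of_nonneg (by positivity), abs_of_nonneg (by positivity)]
      exact Real.rpow_le_rpow_of_exponent_le (not_lt.mp h) (by linarith [hη.2])
  have := hsmall.add_const (c * f x)
  rw [zero_add] at this
  refine this.congr' ?_
  filter_upwards [self_mem_nhdsWithin] with η hη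
  exact (hsplit η hη).symm

/-! ### Dependence on the exponent -/

lemma abs_rpow_mul_log_le {r q : ℝ} (hr : 0 ≤ r) {m : ℕ} (h1 : 1 / 2 ≤ q) (h2 : q ≤ m + 1) :
    |r ^ q * Real.log r| ≤ 2 + r ^ (m + 2) := by
  rcases hr.eq_or_lt with rfl | hr
  · simp
  rcases le_total r 1 with h | h
  · have h3 := Real.abs_log_mul_self_rpow_lt r q hr h (by linarith)
    have h4 : 1 / q ≤ 2 := by
      rw [div_le_iff₀ (by linarith)]; linarith
    rw [mul_comm]
    have : 0 ≤ r ^ (m + 2) := by positivity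
    linarith
  · have h3 : 0 ≤ Real.log r := Real.log_nonneg h
    rw [abs_of_nonneg (by positivity)]
    have h4 : r ^ q ≤ r ^ (m + 1) := by
      rw [← Real.rpow_natCast]
      exact Real.rpow_le_rpow_of_exponent_le h (by push_cast; exact h2)
    calc r ^ q * Real.log r ≤ r ^ (m + 1) * r :=
          mul_le_mul h4 ((Real.log_le_sub_one_of_pos hr).trans (by linarith)) h3 (by positivity)
      _ = r ^ (m + 2) := by ring
      _ ≤ _ := by linarith

/-- Differentiating in the exponent creates the logarithm. With `m ≥ 1` and `|η| < 1/2` the exponent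
stays above `1/2`, which tames `log` at the origin. -/
lemma hasDerivAt_integral_norm_sub_rpow {d : ℕ} {g : RSpace d → ℝ}
    (hg : Continuous g) (hc : HasCompactSupport g) (x : RSpace d) {m : ℕ} (hm : 0 < m) :
    HasDerivAt (fun η : ℝ => ∫ y, g y * ‖y - x‖ ^ (m + η))
      (∫ y, g y * (‖y - x‖ ^ m * Real.log ‖y - x‖)) 0 := by
  have hm1 : (1 : ℝ) ≤ m := by exact_mod_cast hm
  have hs : Metric.ball (0 : ℝ) (1 / 2) ∈ 𝓝 (0 : ℝ) := Metric.ball_mem_nhds _ (by norm_num)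
  have hexp : ∀ η ∈ Metric.ball (0 : ℝ) (1 / 2), 1 / 2 ≤ m + η ∧ m + η ≤ m + 1 := by
    intro η hη
    rw [mem_ball_zero_iff, Real.norm_eq_abs, abs_lt] at hη
    constructor <;> linarith [hη.1, hη.2]
  have hmeas : Measurable fun y : RSpace d => ‖y - x‖ := by fun_prop
  have hcont : ∀ η ∈ Metric.ball (0 : ℝ) (1 / 2),
      Continuous fun y : RSpace d => g y * ‖y - x‖ ^ (m + η) := fun η hη =>
    hg.mul ((by fun_prop : Continuous fun y : RSpace d => ‖y - x‖).rpow_const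
      fun y => Or.inr (by linarith [(hexp η hη).1]))
  have h := hasDerivAt_integral_of_dominated_loc_of_deriv_le (μ := volume)
    (F := fun (η : ℝ) (y : RSpace d) => g y * ‖y - x‖ ^ (m + η))
    (F' := fun (η : ℝ) (y : RSpace d) => g y * (‖y - x‖ ^ (m + η) * Real.log ‖y - x‖))
    (bound := fun y => |g y| * (2 + ‖y - x‖ ^ (m + 2))) hs ?_ ?_ ?_ ?_ ?_ ?_
  · simpa using h.2
  · filter_upwards [hs] with η hη
    exact (hcont η hη).aestronglyMeasurable
  · exact (hcont 0 (by simp)).integrable_of_hasCompactSupport hc.mul_right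
  · exact (hg.measurable.mul ((hmeas.pow_const _).mul hmeas.log)).aestronglyMeasurable
  · refine ae_of_all _ fun y η hη => ?_
    rw [norm_mul, Real.norm_eq_abs, Real.norm_eq_abs]
    exact mul_le_mul_of_nonneg_left
      (abs_rpow_mul_log_le (norm_nonneg _) (hexp η hη).1 (hexp η hη).2) (abs_nonneg _)
  · refine Continuous.integrable_of_hasCompactSupport (by fun_prop) ?_
    exact hc.abs.mul_right
  · refine ae_of_all _ fun y η hη => HasDerivAt.const_mul _ ?_
    rcases (norm_nonneg (y - x)).eq_or_lt with h0 | h0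
    -- At `y = x` the power vanishes for all nearby exponents, in agreement with the default value
    -- `log 0 = 0`.
    · rw [← h0, Real.log_zero, mul_zero]
      refine (hasDerivAt_const η (0 : ℝ)).congr_of_eventuallyEq ?_
      filter_upwards [Metric.isOpen_ball.mem_nhds hη] with η' hη'
      exact Real.zero_rpow (by linarith [(hexp η' hη').1])
    · have := ((hasDerivAt_id η).const_add (m : ℝ)).const_rpow h0
      simpa [mul_comm, mul_assoc] using this

/-! ### The fundamental solution of the iterated Laplacian -/

lemma prod_two_mul_succ (n : ℕ) :
    ∏ i ∈ Finset.range n, (2 * ((i : ℝ) + 1)) = 2 ^ n * (n.factorial : ℝ) := by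
  rw [Finset.prod_mul_distrib, Finset.prod_const, Finset.card_range,
    ← Finset.prod_range_add_one_eq_factorial]
  push_cast
  rfl

/-- The Gamma recurrence, applicable because `d/2 - k` is never zero for odd `d`; it matches the odd
normalization. -/
lemma gamma_sub_mul_prod {d : ℕ} (hd : ¬ Even d) (k : ℕ) :
    Real.Gamma ((d : ℝ) / 2 - k) * ∏ i ∈ Finset.range k, (2 * ((i : ℝ) + 1) - d) =
      (-1) ^ k * 2 ^ k * Real.Gamma ((d : ℝ) / 2) := by
  induction k with
  | zero => simp
  | succ k ih =>
    have h0 : (d : ℝ) / 2 - (k + 1 : ℕ) ≠ 0 := by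
      intro h
      apply hd
      have : (d : ℝ) = ((k + 1 : ℕ) : ℝ) + (k + 1 : ℕ) := by linarith
      exact ⟨k + 1, by exact_mod_cast this⟩
    have h1 := Real.Gamma_add_one h0
    rw [show (d : ℝ) / 2 - (k + 1 : ℕ) + 1 = (d : ℝ) / 2 - k by push_cast; ring] at h1
    rw [h1] at ih
    rw [Finset.prod_range_succ, pow_succ, pow_succ]
    push_cast at ih ⊢
    linear_combination (-2) * ih

/-- For `d = 2(a+1)` the erased factor is the one that vanishes; the `a` factors below it are
negative, the `j` above positive. -/
lemma prod_erase_sub (a j : ℕ) :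
    ∏ i ∈ (Finset.range (a + 1 + j)).erase a, (2 * ((i : ℝ) + 1) - 2 * (a + 1)) =
      2 ^ (a + j) * ((-1) ^ a * (a.factorial : ℝ) * (j.factorial : ℝ)) := by
  induction j with
  | zero =>
    have h1 : (Finset.range (a + 1 + 0)).erase a = Finset.range a := by
      ext i; simp; omega
    rw [h1, ← Finset.prod_range_reflect]
    have h2 : ∀ i ∈ Finset.range a, (2 * (((a - 1 - i : ℕ) : ℝ) + 1) - 2 * (a + 1)) =
        (-1) * (2 * ((i : ℝ) + 1)) := by
      intro i hi
      have h3 : ((a - 1 - i : ℕ) : ℝ) = a - 1 - i := by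
        rw [Finset.mem_range] at hi
        rw [Nat.sub_sub, Nat.cast_sub (by omega)]
        push_cast; ring
      rw [h3]; ring
    rw [Finset.prod_congr rfl h2, Finset.prod_mul_distrib, prod_two_mul_succ]
    simp
    ring
  | succ j ih =>
    have h1 : (Finset.range (a + 1 + (j + 1))).erase a =
        insert (a + 1 + j) ((Finset.range (a + 1 + j)).erase a) := by
      ext i; simp; omega
    rw [h1, Finset.prod_insert (by simp), ih, Nat.factorial_succ]
    push_cast
    ring

lemma card_mul_volume_ball {d : ℕ} (hd : 0 < d) :
    d * volume.real (Metric.ball (0 : RSpace d) 1) =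
      2 * Real.pi ^ ((d : ℝ) / 2) / Real.Gamma ((d : ℝ) / 2) := by
  have : Nonempty (Fin d) := ⟨⟨0, hd⟩⟩
  have hd' : (0 : ℝ) < d := by exact_mod_cast hd
  have hG : 0 < Real.Gamma ((d : ℝ) / 2) := Real.Gamma_pos_of_pos (by positivity)
  rw [measureReal_def, EuclideanSpace.volume_ball, Fintype.card_fin, Real.Gamma_add_one (by positivity)]
  have h1 : √Real.pi ^ d = Real.pi ^ ((d : ℝ) / 2) := by
    rw [Real.sqrt_eq_rpow, ← Real.rpow_natCast, ← Real.rpow_mul Real.pi_pos.le]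
    congr 1; ring
  rw [h1, ENNReal.ofReal_one, one_pow, one_mul, ENNReal.toReal_ofReal (by positivity)]
  field_simp

/-- Take `p = η - d` in the iterated formula: the factor `p + 2i + d` at `i = 0` is `η`, and is kept
with the integral to form the approximate identity. -/
lemma integral_iteratedLaplacian_mul_rpow_eq {d k : ℕ} (hd : 0 < d) (hk : d < 2 * k)
    {f : RSpace d → ℝ} (hf : ContDiff ℝ (2 * k : ℕ) f) (hc : HasCompactSupport f) (x : RSpace d)
    {η : ℝ} (hη : 0 < η) :
    ∫ y, iteratedLaplacian k f y * ‖y - x‖ ^ (((2 * k - d : ℕ) : ℝ) + η) =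
      (∏ i ∈ Finset.range k, (2 * ((i : ℝ) + 1) - d + η)) *
        (∏ i ∈ Finset.range (k - 1), (2 * ((i : ℝ) + 1) + η)) *
          (η * ∫ y, f y * ‖y - x‖ ^ (η - d)) := by
  obtain ⟨k, rfl⟩ : ∃ j, k = j + 1 := ⟨k - 1, by omega⟩
  have h := integral_iteratedLaplacian_mul_norm_sub_rpow hd (k + 1) hf hc x (p := η - d)
    (by linarith)
  rw [show η - d + 2 * ((k + 1 : ℕ) : ℝ) = ((2 * (k + 1) - d : ℕ) : ℝ) + η by
    push_cast [Nat.cast_sub hk.le]; ring] at h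
  rw [h, Finset.prod_mul_distrib, Finset.prod_range_succ' (fun i : ℕ => η - d + 2 * (i : ℝ) + d)]
  have e1 : ∏ i ∈ Finset.range (k + 1), (η - d + 2 * ((i : ℝ) + 1)) =
      ∏ i ∈ Finset.range (k + 1), (2 * ((i : ℝ) + 1) - d + η) :=
    Finset.prod_congr rfl fun i _ => by ring
  have e2 : ∏ i ∈ Finset.range k, (η - d + 2 * ((i + 1 : ℕ) : ℝ) + d) =
      ∏ i ∈ Finset.range (k + 1 - 1), (2 * ((i : ℝ) + 1) + η) :=
    Finset.prod_congr rfl fun i _ => by push_cast; ring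
  rw [e1, e2]
  push_cast
  ring

lemma tendsto_prod_add {ι : Type*} (s : Finset ι) (c : ι → ℝ) :
    Tendsto (fun η : ℝ => ∏ i ∈ s, (c i + η)) (𝓝[>] 0) (𝓝 (∏ i ∈ s, c i)) := by
  have h : Continuous fun η : ℝ => ∏ i ∈ s, (c i + η) := by fun_prop
  have := h.tendsto 0
  simp only [add_zero] at this
  exact this.mono_left nhdsWithin_le_nhds

lemma integral_iteratedLaplacian_mul_pow {d k : ℕ} (hd : 0 < d) (hk : d < 2 * k)
    {f : RSpace d → ℝ} (hf : ContDiff ℝ (2 * k : ℕ) f) (hc : HasCompactSupport f)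
    (x : RSpace d) :
    ∫ y, iteratedLaplacian k f y * ‖y - x‖ ^ (2 * k - d) =
      (∏ i ∈ Finset.range k, (2 * ((i : ℝ) + 1) - d)) *
        (2 ^ (k - 1) * ((k - 1).factorial : ℝ)) *
          (d * volume.real (Metric.ball (0 : RSpace d) 1) * f x) := by
  obtain ⟨hgc, hgs⟩ := iteratedLaplacian_regular k hf hc
  have h1 := (hasDerivAt_integral_norm_sub_rpow hgc hgs x
    (m := 2 * k - d) (by omega)).continuousAt.tendsto.mono_left
      (nhdsWithin_le_nhds (s := Set.Ioi (0 : ℝ)))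
  simp only [add_zero, Real.rpow_natCast] at h1
  have h2 := ((tendsto_prod_add (Finset.range k) fun i : ℕ => 2 * ((i : ℝ) + 1) - d).mul
    (tendsto_prod_add (Finset.range (k - 1)) fun i : ℕ => 2 * ((i : ℝ) + 1))).mul
      (tendsto_mul_integral_norm_sub_rpow hd
        (hf.of_le (by norm_cast; omega)) hc x)
  rw [prod_two_mul_succ] at h2
  refine tendsto_nhds_unique (h1.congr' ?_) h2
  filter_upwards [self_mem_nhdsWithin] with η hη
  exact integral_iteratedLaplacian_mul_rpow_eq hd hk hf hc x hη

/-- The factor with index `a` equals `η`, so the integral vanishes at `η = 0` and its slope there is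
the product without that factor; the slope also tends to the derivative, the logarithmic integral.
-/
lemma integral_iteratedLaplacian_mul_pow_mul_log {a k : ℕ} (hk : 2 * (a + 1) < 2 * k)
    {f : RSpace (2 * (a + 1)) → ℝ} (hf : ContDiff ℝ (2 * k : ℕ) f) (hc : HasCompactSupport f)
    (x : RSpace (2 * (a + 1))) :
    ∫ y, iteratedLaplacian k f y * (‖y - x‖ ^ (2 * k - 2 * (a + 1)) * Real.log ‖y - x‖) =
      (∏ i ∈ (Finset.range k).erase a, (2 * ((i : ℝ) + 1) - 2 * (a + 1))) *
        (2 ^ (k - 1) * ((k - 1).factorial : ℝ)) *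
          ((2 * (a + 1) : ℕ) *
            volume.real (Metric.ball (0 : RSpace (2 * (a + 1))) 1) * f x) := by
  have hd : 0 < 2 * (a + 1) := by omega
  obtain ⟨hgc, hgs⟩ := iteratedLaplacian_regular k hf hc
  have hak : a ∈ Finset.range k := by rw [Finset.mem_range]; omega
  have h0 := integral_iteratedLaplacian_mul_pow hd hk hf hc x
  rw [Finset.prod_eq_zero hak (by push_cast; ring), zero_mul, zero_mul] at h0
  have h1 := (hasDerivAt_iff_tendsto_slope.mp (hasDerivAt_integral_norm_sub_rpow hgc hgs x
    (m := 2 * k - 2 * (a + 1)) (by omega))).mono_left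
      (nhdsWithin_mono 0 (fun η (hη : η ∈ Set.Ioi (0 : ℝ)) => hη.ne'))
  have h2 := ((tendsto_prod_add ((Finset.range k).erase a)
    fun i : ℕ => 2 * ((i : ℝ) + 1) - 2 * (a + 1)).mul
    (tendsto_prod_add (Finset.range (k - 1)) fun i : ℕ => 2 * ((i : ℝ) + 1))).mul
      (tendsto_mul_integral_norm_sub_rpow hd
        (hf.of_le (by norm_cast; omega)) hc x)
  rw [prod_two_mul_succ] at h2
  refine tendsto_nhds_unique (h1.congr' ?_) h2
  filter_upwards [self_mem_nhdsWithin] with η hη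
  have hη' : η ≠ 0 := ne_of_gt hη
  rw [slope_def_field]
  simp only [add_zero, Real.rpow_natCast, sub_zero]
  rw [h0, integral_iteratedLaplacian_mul_rpow_eq hd hk hf hc x hη, ← Finset.mul_prod_erase _ _ hak]
  push_cast
  field_simp
  ring

theorem integral_iteratedLaplacian_mul_surfaceSpline {d k : ℕ} (hd : 0 < d) (hk : d < 2 * k)
    {f : RSpace d → ℝ} (hf : ContDiff ℝ (2 * k : ℕ) f) (hc : HasCompactSupport f)
    (x : RSpace d) :
    ∫ y, iteratedLaplacian k f y * surfaceSpline d k (x - y) = f x := by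
  have hpi := Real.pi_pos
  have h4 : (4 : ℝ) ^ k = 2 ^ k * 2 ^ k := by rw [← mul_pow]; norm_num
  have hk1 : (2 : ℝ) ^ k = 2 * 2 ^ (k - 1) := by
    rw [← pow_succ']; congr 1; omega
  have hmul : ∀ (c : ℝ) (g : RSpace d → ℝ), ∫ y, iteratedLaplacian k f y * (c * g y) =
      c * ∫ y, iteratedLaplacian k f y * g y := fun c g => by
    rw [← integral_const_mul]
    exact integral_congr_ae (ae_of_all _ fun y => mul_left_comm _ _ _)
  by_cases hev : Even d
  · obtain ⟨a, rfl⟩ : ∃ a, d = 2 * (a + 1) := by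
      obtain ⟨r, hr⟩ := hev
      exact ⟨r - 1, by omega⟩
    obtain ⟨j, rfl⟩ : ∃ j, k = a + 1 + j := ⟨k - (a + 1), by omega⟩
    have hdiv : 2 * (a + 1) / 2 = a + 1 := by omega
    have h := integral_iteratedLaplacian_mul_pow_mul_log hk hf hc x
    rw [prod_erase_sub, card_mul_volume_ball hd] at h
    rw [show ((2 * (a + 1) : ℕ) : ℝ) / 2 = ((a + 1 : ℕ) : ℝ) by push_cast; ring,
      Real.rpow_natCast, Nat.cast_succ, Real.Gamma_nat_eq_factorial] at h
    simp only [surfaceSpline, hev, if_true, hdiv, norm_sub_rev x]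
    rw [hmul, h, h4, hk1]
    have e1 : a + 1 + j - (a + 1) = j := by omega
    have e2 : a + 1 + j - 1 = a + j := by omega
    rw [e1, e2]
    have hs : ((-1 : ℝ)) ^ (a + 1 + 1) * (-1) ^ a = 1 := by
      rw [← pow_add]; exact Even.neg_one_pow ⟨a + 1, by ring⟩
    have f1 : (a.factorial : ℝ) ≠ 0 := by positivity
    have f2 : (j.factorial : ℝ) ≠ 0 := by positivity
    have f3 : ((a + j).factorial : ℝ) ≠ 0 := by positivity
    field_simp
    linear_combination (f x) * hs
  · have h := integral_iteratedLaplacian_mul_pow hd hk hf hc x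
    rw [card_mul_volume_ball hd] at h
    simp only [surfaceSpline, hev, if_false, norm_sub_rev x]
    rw [hmul, h]
    have hG := gamma_sub_mul_prod hev k
    have hG0 : Real.Gamma ((d : ℝ) / 2) ≠ 0 := (Real.Gamma_pos_of_pos (by positivity)).ne'
    have f1 : ((k - 1).factorial : ℝ) ≠ 0 := by positivity
    have hp : Real.pi ^ ((d : ℝ) / 2) ≠ 0 := by positivity
    have hs : ((-1 : ℝ)) ^ k * (-1) ^ k = 1 := by
      rw [← mul_pow]; norm_num
    have h2 : (2 : ℝ) ^ (k - 1) ≠ 0 := by positivity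
    set G := Real.Gamma ((d : ℝ) / 2 - k)
    set P := ∏ i ∈ Finset.range k, (2 * ((i : ℝ) + 1) - d)
    calc _ = (-1) ^ k * (G * P) * (2 ^ (k - 1) * 2 * f x) /
          (4 ^ k * Real.Gamma ((d : ℝ) / 2)) := by field_simp
      _ = _ := by
        rw [hG, h4, hk1]
        field_simp
        linear_combination (f x) * hs

/-! ### Polynomial functions of bounded total degree -/

/-- `g` is a polynomial function of total degree at most `n`. -/
def IsPolyOfDegreeLE {d : ℕ} (n : ℕ) (g : RSpace d → ℝ) : Prop :=
  ∃ p : MvPolynomial (Fin d) ℝ, p.totalDegree ≤ n ∧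
    ∀ v : RSpace d, MvPolynomial.eval (fun i => v i) p = g v

namespace IsPolyOfDegreeLE

variable {d : ℕ}

lemma mono {n n' : ℕ} {g : RSpace d → ℝ} (h : IsPolyOfDegreeLE n g) (hn : n ≤ n') :
    IsPolyOfDegreeLE n' g :=
  h.imp fun _ hp => ⟨hp.1.trans hn, hp.2⟩

lemma const (c : ℝ) (n : ℕ) : IsPolyOfDegreeLE n fun _ : RSpace d => c :=
  ⟨MvPolynomial.C c, by simp, by simp⟩

lemma coord (i : Fin d) : IsPolyOfDegreeLE 1 fun v : RSpace d => v i :=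
  ⟨MvPolynomial.X i, by simp, by simp⟩

lemma add {n : ℕ} {g h : RSpace d → ℝ} (hg : IsPolyOfDegreeLE n g) (hh : IsPolyOfDegreeLE n h) :
    IsPolyOfDegreeLE n fun v => g v + h v := by
  obtain ⟨p, hp, hp'⟩ := hg
  obtain ⟨q, hq, hq'⟩ := hh
  exact ⟨p + q, (MvPolynomial.totalDegree_add _ _).trans (max_le hp hq), fun v => by
    rw [map_add, hp', hq']⟩

lemma mul {n n' : ℕ} {g h : RSpace d → ℝ} (hg : IsPolyOfDegreeLE n g)
    (hh : IsPolyOfDegreeLE n' h) : IsPolyOfDegreeLE (n + n') fun v => g v * h v := by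
  obtain ⟨p, hp, hp'⟩ := hg
  obtain ⟨q, hq, hq'⟩ := hh
  exact ⟨p * q, (MvPolynomial.totalDegree_mul _ _).trans (add_le_add hp hq), fun v => by
    rw [map_mul, hp', hq']⟩

lemma const_mul {n : ℕ} {g : RSpace d → ℝ} (hg : IsPolyOfDegreeLE n g) (c : ℝ) :
    IsPolyOfDegreeLE n fun v => c * g v :=
  ((const c 0).mul hg).mono (zero_add n).le

lemma sum {n : ℕ} {ι : Type*} {s : Finset ι} {g : ι → RSpace d → ℝ}
    (hg : ∀ i ∈ s, IsPolyOfDegreeLE n (g i)) : IsPolyOfDegreeLE n fun v => ∑ i ∈ s, g i v := by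
  classical
  induction s using Finset.induction_on with
  | empty => simpa using const 0 n
  | insert i s hi ih =>
    simp only [Finset.sum_insert hi]
    exact (hg i (by simp)).add (ih fun j hj => hg j (by simp [hj]))

lemma prod {n : ℕ} {ι : Type*} {s : Finset ι} {g : ι → RSpace d → ℝ}
    (hg : ∀ i ∈ s, IsPolyOfDegreeLE n (g i)) :
    IsPolyOfDegreeLE (s.card * n) fun v => ∏ i ∈ s, g i v := by
  classical
  induction s using Finset.induction_on with
  | empty => simpa using const 1 0
  | insert i s hi ih =>
    simp only [Finset.prod_insert hi, Finset.card_insert_of_notMem hi]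
    exact ((hg i (by simp)).mul (ih fun j hj => hg j (by simp [hj]))).mono (by ring_nf; rfl)

lemma pow {n : ℕ} {g : RSpace d → ℝ} (hg : IsPolyOfDegreeLE n g) (j : ℕ) :
    IsPolyOfDegreeLE (j * n) fun v => g v ^ j := by
  simpa using prod (s := Finset.range j) fun _ _ => hg

lemma sub {n : ℕ} {g h : RSpace d → ℝ} (hg : IsPolyOfDegreeLE n g) (hh : IsPolyOfDegreeLE n h) :
    IsPolyOfDegreeLE n fun v => g v - h v := by
  simpa only [neg_one_mul, ← sub_eq_add_neg] using hg.add (hh.const_mul (-1))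

lemma clm (L : RSpace d →L[ℝ] ℝ) : IsPolyOfDegreeLE 1 fun v => L v := by
  have h : ∀ v : RSpace d, L v = ∑ i, L (EuclideanSpace.single i 1) * v i := by
    intro v
    conv_lhs => rw [← (EuclideanSpace.basisFun (Fin d) ℝ).sum_repr v]
    simp [mul_comm]
  rw [show (fun v => L v) = _ from funext h]
  exact sum fun i _ => (coord i).const_mul _

lemma norm_sub_pow {m : ℕ} (hm : Even m) (x : RSpace d) :
    IsPolyOfDegreeLE m fun v => ‖x - v‖ ^ m := by
  obtain ⟨j, rfl⟩ := hm
  have h : ∀ v : RSpace d, ‖x - v‖ ^ (j + j) = (∑ i, (x i - v i) ^ 2) ^ j := by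
    intro v
    rw [← two_mul, pow_mul, EuclideanSpace.norm_sq_eq]
    simp
  simp_rw [h]
  refine (pow (n := 2) (sum fun i _ => ?_) j).mono (by omega)
  exact (((const (x i) 1).sub (coord i)).pow 2).mono (by norm_num)

/-- Expansion in the standard basis; it makes Taylor partial sums eligible for reproduction. -/
lemma multilinear_comp {j : ℕ} (M : ContinuousMultilinearMap ℝ (fun _ : Fin j => RSpace d) ℝ)
    {A : RSpace d → RSpace d} (hA : ∀ i, IsPolyOfDegreeLE 1 fun v => A v i) :
    IsPolyOfDegreeLE j fun v => M fun _ => A v := by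
  have h : ∀ v : RSpace d, (M fun _ => A v) = ∑ r : Fin j → Fin d,
      (M fun i => EuclideanSpace.single (r i) 1) * ∏ i, A v (r i) := by
    intro v
    have e : A v = ∑ i, A v i • EuclideanSpace.single i (1 : ℝ) := by
      conv_lhs => rw [← (EuclideanSpace.basisFun (Fin d) ℝ).sum_repr (A v)]
      simp
    conv_lhs => rw [e]
    rw [M.map_sum]
    refine Finset.sum_congr rfl fun r _ => ?_
    rw [M.map_smul_univ (fun i => A v (r i)) fun i => EuclideanSpace.single (r i) 1, smul_eq_mul,
      mul_comm]
  simp_rw [h]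
  refine sum fun r _ => const_mul ?_ _
  exact (prod fun i _ => hA (r i)).mono (by simp)

end IsPolyOfDegreeLE

/-! ### Consequences of polynomial reproduction -/

section Reproduction

variable {d ℓ : ℕ} {Ξ : Set (RSpace d)} {ρ : RSpace d → ℝ} {a : Ξ → RSpace d → ℝ} {K : ℝ}

lemma IsLocalDensity.hasSum_poly (h : IsLocalDensity Ξ ρ a ℓ K) {n : ℕ} (hn : n < ℓ)
    {g : RSpace d → ℝ} (hg : IsPolyOfDegreeLE n g) (α : RSpace d) :
    HasSum (fun ξ : Ξ => a ξ α * g ξ) (g α) := by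
  obtain ⟨p, hp, hp'⟩ := hg
  simpa only [hp'] using h.precision p (hp.trans_lt hn) α

lemma IsLocalDensity.summable_and_abs_tsum_le (h : IsLocalDensity Ξ ρ a ℓ K) (α : RSpace d)
    {g : RSpace d → ℝ} {B : ℝ} (hB : 0 ≤ B) (hg : ∀ ξ, ‖ξ - α‖ ≤ ρ α → |g ξ| ≤ B) :
    Summable (fun ξ : Ξ => a ξ α * g ξ) ∧ |∑' ξ : Ξ, a ξ α * g ξ| ≤ K * B := by
  have hb : ∀ ξ : Ξ, ‖a ξ α * g ξ‖ ≤ |a ξ α| * B := by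
    intro ξ
    rw [norm_mul, Real.norm_eq_abs, Real.norm_eq_abs]
    by_cases hξ : ‖(ξ : RSpace d) - α‖ ≤ ρ α
    · exact mul_le_mul_of_nonneg_left (hg ξ hξ) (abs_nonneg _)
    · simp [h.support ξ α (not_le.mp hξ)]
  have hs := (h.summable α).mul_right B
  refine ⟨Summable.of_norm_bounded hs hb, ?_⟩
  rw [← Real.norm_eq_abs]
  calc _ ≤ ∑' ξ : Ξ, |a ξ α| * B := tsum_of_norm_bounded hs.hasSum hb
    _ = (∑' ξ : Ξ, |a ξ α|) * B := tsum_mul_right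
    _ ≤ _ := mul_le_mul_of_nonneg_right (h.stability α).le hB

end Reproduction

/-! ### Structure of the surface spline -/

lemma continuous_surfaceSpline {d k : ℕ} (hk : d < 2 * k) :
    Continuous (surfaceSpline d k) := by
  unfold surfaceSpline
  split_ifs
  · refine continuous_const.mul ?_
    have h : ∀ x : RSpace d, ‖x‖ ^ (2 * k - d) * Real.log ‖x‖ =
        ‖x‖ ^ (2 * k - d - 1) * (‖x‖ * Real.log ‖x‖) := by
      intro x
      rw [← mul_assoc, ← pow_succ]
      congr 2
      omega
    simp_rw [h]
    exact (continuous_norm.pow _).mul (Real.continuous_mul_log.comp continuous_norm)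
  · fun_prop

lemma analyticAt_surfaceSpline {d k : ℕ} {u : RSpace d} (hu : u ≠ 0) :
    AnalyticAt ℝ (surfaceSpline d k) u := by
  have h : AnalyticAt ℝ (fun x : RSpace d => ‖x‖) u := (contDiffAt_norm ℝ hu).analyticAt
  unfold surfaceSpline
  split_ifs
  · exact analyticAt_const.mul ((h.pow _).mul ((analyticAt_log (norm_pos_iff.mpr hu)).comp h))
  · exact analyticAt_const.mul (h.pow _)

lemma surfaceSpline_congr_norm {d k : ℕ} {u v : RSpace d} (h : ‖u‖ = ‖v‖) :
    surfaceSpline d k u = surfaceSpline d k v := by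
  simp only [surfaceSpline, h]

/-- Only `log (R‖z‖)` breaks homogeneity, and only for even `d`. The disjunction records that the
extra term is then always polynomial. -/
lemma surfaceSpline_smul {d k : ℕ} (hk : d < 2 * k) {R : ℝ} (hR : 0 < R) :
    ∃ c : ℝ, (c = 0 ∨ Even (2 * k - d)) ∧ ∀ z : RSpace d,
      surfaceSpline d k (R • z) = R ^ (2 * k - d) * surfaceSpline d k z +
        c * ‖z‖ ^ (2 * k - d) := by
  unfold surfaceSpline
  split_ifs with hd
  · set A : ℝ := (-1) ^ (d / 2 + 1) * 2 / (4 ^ k * Real.pi ^ (d / 2) *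
      (Nat.factorial (k - 1) : ℝ) * (Nat.factorial (k - d / 2) : ℝ))
    refine ⟨A * R ^ (2 * k - d) * Real.log R, Or.inr ?_, fun z => ?_⟩
    · exact (Nat.even_sub hk.le).mpr (by simp [hd])
    · rw [norm_smul, Real.norm_of_nonneg hR.le]
      rcases (norm_nonneg z).eq_or_lt with hz | hz
      · rw [← hz, mul_zero, zero_pow (by omega)]
        simp
      · rw [Real.log_mul hR.ne' hz.ne', mul_pow]
        ring
  · refine ⟨0, Or.inl rfl, fun z => ?_⟩
    rw [norm_smul, Real.norm_of_nonneg hR.le, mul_pow]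
    ring

lemma exists_reflection_unit {d : ℕ} {u e : RSpace d} (h : ‖u‖ = ‖e‖) :
    ∃ Q : RSpace d ≃ₗᵢ[ℝ] RSpace d, Q u = e :=
  ⟨_, Submodule.reflection_sub h⟩

/-- Expand analytically at one fixed unit vector and transport by a reflection; `φ` is radial, so
`δ` and `C` do not depend on `u`. -/
lemma exists_surfaceSpline_expansion {d k : ℕ} (hd : 0 < d) {ℓ : ℕ} (hℓ : 0 < ℓ) :
    ∃ δ > 0, ∃ C > 0, ∀ u : RSpace d, ‖u‖ = 1 → ∃ P : RSpace d → ℝ,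
      (∀ (t : ℝ) (b : RSpace d), IsPolyOfDegreeLE (ℓ - 1) fun ξ => P (t • (b - ξ))) ∧
      ∀ v, ‖v‖ ≤ δ → |surfaceSpline d k (u + v) - P v| ≤ C * ‖v‖ ^ ℓ := by
  set e : RSpace d := EuclideanSpace.single ⟨0, hd⟩ 1 with he
  have he1 : ‖e‖ = 1 := by simp [he]
  obtain ⟨p, hp⟩ := analyticAt_surfaceSpline (k := k) (norm_ne_zero_iff.mp (he1 ▸ one_ne_zero))
  obtain ⟨C, hC, hO⟩ := (hp.isBigO_sub_partialSum_pow ℓ).exists_pos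
  obtain ⟨δ, hδ, hball⟩ := Metric.eventually_nhds_iff_ball.mp hO.bound
  refine ⟨δ / 2, by positivity, C, hC, fun u hu => ?_⟩
  obtain ⟨Q, hQ⟩ := exists_reflection_unit (hu.trans he1.symm)
  refine ⟨fun v => p.partialSum ℓ (Q v), fun t b => ?_, fun v hv => ?_⟩
  · simp only [FormalMultilinearSeries.partialSum]
    refine IsPolyOfDegreeLE.sum fun j hj => ?_
    refine (IsPolyOfDegreeLE.multilinear_comp (p j) (A := fun ξ => Q (t • (b - ξ)))
      fun i => ?_).mono (by rw [Finset.mem_range] at hj; omega)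
    have hL := IsPolyOfDegreeLE.clm
      ((EuclideanSpace.proj (𝕜 := ℝ) i : RSpace d →L[ℝ] ℝ).comp
        (Q.toContinuousLinearEquiv : RSpace d →L[ℝ] RSpace d))
    simpa using ((IsPolyOfDegreeLE.const (Q b i) 1).sub hL).const_mul t
  · have h1 := hball (Q v) (by rw [mem_ball_zero_iff, Q.norm_map]; linarith)
    rw [norm_pow, norm_norm, Q.norm_map, Real.norm_eq_abs] at h1
    rwa [surfaceSpline_congr_norm (u := u + v) (v := e + Q v) (by rw [← hQ, ← map_add, Q.norm_map])]

/-! ### Error of the local approximation of the kernel -/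

section KernelError

variable {d k ℓ : ℕ} {Ξ : Set (RSpace d)} {ρ : RSpace d → ℝ} {a : Ξ → RSpace d → ℝ} {K : ℝ}

lemma IsLocalDensity.summable_mul_continuous (h : IsLocalDensity Ξ ρ a ℓ K) (α : RSpace d)
    {g : RSpace d → ℝ} (hg : Continuous g) : Summable fun ξ : Ξ => a ξ α * g ξ := by
  obtain ⟨B, hB⟩ := (isCompact_closedBall α (ρ α)).exists_bound_of_continuousOn hg.continuousOn
  refine (h.summable_and_abs_tsum_le α (le_max_right B 0) fun ξ hξ => ?_).1
  exact (hB ξ (by rwa [mem_closedBall_iff_norm])).trans (le_max_left _ _)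

lemma continuous_surfaceSpline_sub (hk : d < 2 * k) (x : RSpace d) (R : ℝ) :
    Continuous fun ξ : RSpace d => surfaceSpline d k (R • (x - ξ)) :=
  (continuous_surfaceSpline hk).comp (by fun_prop)

/-- The error of the local approximation is compatible with dilations. -/
lemma IsLocalDensity.splineKernel_sub_eq (h : IsLocalDensity Ξ ρ a ℓ K) (hk : d < 2 * k)
    (hℓ : 2 * k - d < ℓ) (x α : RSpace d) {R : ℝ} (hR : 0 < R) :
    splineKernel k a x α - surfaceSpline d k (x - α) =
      R ^ (2 * k - d) * (∑' ξ : Ξ, a ξ α * surfaceSpline d k (R⁻¹ • (x - ξ)) -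
        surfaceSpline d k (R⁻¹ • (x - α))) := by
  obtain ⟨c, hc, hφ⟩ := surfaceSpline_smul hk hR
  have hφ' : ∀ ξ : RSpace d, surfaceSpline d k (x - ξ) =
      R ^ (2 * k - d) * surfaceSpline d k (R⁻¹ • (x - ξ)) +
        c * R⁻¹ ^ (2 * k - d) * ‖x - ξ‖ ^ (2 * k - d) := by
    intro ξ
    have := hφ (R⁻¹ • (x - ξ))
    rw [smul_inv_smul₀ hR.ne', norm_smul, Real.norm_of_nonneg (by positivity), mul_pow] at this
    rw [this]
    ring
  have hpoly : IsPolyOfDegreeLE (2 * k - d)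
      fun ξ : RSpace d => c * R⁻¹ ^ (2 * k - d) * ‖x - ξ‖ ^ (2 * k - d) := by
    rcases hc with rfl | hc
    · simpa using IsPolyOfDegreeLE.const 0 _
    · exact (IsPolyOfDegreeLE.norm_sub_pow hc x).const_mul _
  have h1 := h.hasSum_poly hℓ hpoly α
  have h2 := (h.summable_mul_continuous α
    (continuous_surfaceSpline_sub hk x R⁻¹)).hasSum.mul_left (R ^ (2 * k - d))
  rw [splineKernel, tsum_congr fun ξ : Ξ => (by rw [hφ' ξ]; ring :
    a ξ α * surfaceSpline d k (x - ξ) =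
      R ^ (2 * k - d) * (a ξ α * surfaceSpline d k (R⁻¹ • (x - ξ))) +
        a ξ α * (c * R⁻¹ ^ (2 * k - d) * ‖x - ξ‖ ^ (2 * k - d))), (h2.add h1).tsum_eq, hφ' α]
  ring

/-- After scaling by `R`, all contributing centers lie where `|φ| ≤ B`; stability gives `K * B`, and
the subtracted value gives `B`. -/
lemma IsLocalDensity.abs_splineKernel_sub_le_of_near (h : IsLocalDensity Ξ ρ a ℓ K)
    (hk : d < 2 * k) (hℓ : 2 * k - d < ℓ) {M N B : ℝ} (hB : 0 ≤ B)
    (hφ : ∀ z : RSpace d, ‖z‖ ≤ M + N → |surfaceSpline d k z| ≤ B) {x α : RSpace d} {R : ℝ}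
    (hR : 0 < R) (h1 : ‖x - α‖ ≤ M * R) (h2 : ρ α ≤ N * R) :
    |splineKernel k a x α - surfaceSpline d k (x - α)| ≤ R ^ (2 * k - d) * (K * B + B) := by
  have hN : 0 ≤ N := by
    have := h.pos α
    by_contra hN
    nlinarith
  rw [h.splineKernel_sub_eq hk hℓ x α hR, abs_mul, abs_of_nonneg (by positivity)]
  refine mul_le_mul_of_nonneg_left ((abs_sub _ _).trans (add_le_add ?_ (hφ _ ?_))) (by positivity)
  · refine (h.summable_and_abs_tsum_le α (g := fun ξ => surfaceSpline d k (R⁻¹ • (x - ξ))) hB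
      fun ξ hξ => hφ _ ?_).2
    rw [norm_smul, Real.norm_of_nonneg (by positivity), inv_mul_le_iff₀ hR]
    calc ‖x - ξ‖ ≤ ‖x - α‖ + ‖α - ξ‖ := norm_sub_le_norm_sub_add_norm_sub _ _ _
      _ ≤ M * R + N * R := add_le_add h1 (by rw [norm_sub_rev]; exact hξ.trans h2)
      _ = R * (M + N) := by ring
  · rw [norm_smul, Real.norm_of_nonneg (by positivity), inv_mul_le_iff₀ hR]
    nlinarith

/-- Scaling by `‖x - α‖` puts the base point on the unit sphere. Reproduction cancels the Taylor
polynomial, so only its remainder, of order `ℓ`, is summed. -/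
lemma IsLocalDensity.abs_splineKernel_sub_le_of_far (h : IsLocalDensity Ξ ρ a ℓ K)
    (hk : d < 2 * k) (hℓ : 2 * k - d < ℓ) {δ C : ℝ} (hC : 0 < C)
    (hexp : ∀ u : RSpace d, ‖u‖ = 1 → ∃ P : RSpace d → ℝ,
      (∀ (t : ℝ) (b : RSpace d), IsPolyOfDegreeLE (ℓ - 1) fun ξ => P (t • (b - ξ))) ∧
      ∀ v, ‖v‖ ≤ δ → |surfaceSpline d k (u + v) - P v| ≤ C * ‖v‖ ^ ℓ)
    {x α : RSpace d} (hx : 0 < ‖x - α‖) (hρ : ρ α / ‖x - α‖ ≤ δ) :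
    |splineKernel k a x α - surfaceSpline d k (x - α)| ≤
      ‖x - α‖ ^ (2 * k - d) * (K * (C * (ρ α / ‖x - α‖) ^ ℓ)) := by
  set t := ‖x - α‖ with ht
  have hρ0 := h.pos α
  obtain ⟨P, hP, hPb⟩ := hexp (t⁻¹ • (x - α)) (by
    rw [norm_smul, Real.norm_of_nonneg (by positivity), ← ht, inv_mul_cancel₀ hx.ne'])
  -- The remainder bound at `v = 0` forces equality, as `0 ^ ℓ = 0`.
  have hP0 : surfaceSpline d k (t⁻¹ • (x - α)) = P 0 := by
    have := hPb 0 (by rw [norm_zero]; exact (by positivity : 0 ≤ ρ α / t).trans hρ)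
    rw [norm_zero, zero_pow (by omega), mul_zero, add_zero] at this
    linarith [abs_nonpos_iff.mp this]
  have hsplit : ∀ ξ : RSpace d, surfaceSpline d k (t⁻¹ • (x - ξ)) =
      surfaceSpline d k (t⁻¹ • (x - α) + t⁻¹ • (α - ξ)) := by
    intro ξ
    rw [← smul_add, sub_add_sub_cancel]
  rw [h.splineKernel_sub_eq hk hℓ x α hx, abs_mul, abs_of_nonneg (by positivity)]
  refine mul_le_mul_of_nonneg_left ?_ (by positivity)
  have h1 := h.hasSum_poly (by omega) (hP t⁻¹ α) α
  rw [sub_self, smul_zero, ← hP0] at h1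
  have h2 := ((h.summable_mul_continuous α (continuous_surfaceSpline_sub hk x t⁻¹)).hasSum.sub h1)
  simp_rw [← mul_sub] at h2
  rw [← h2.tsum_eq]
  refine (h.summable_and_abs_tsum_le α
    (g := fun ξ => surfaceSpline d k (t⁻¹ • (x - ξ)) - P (t⁻¹ • (α - ξ)))
    (by positivity) fun ξ hξ => ?_).2
  have h3 : ‖t⁻¹ • (α - ξ)‖ ≤ ρ α / t := by
    rw [norm_smul, Real.norm_of_nonneg (by positivity), div_eq_inv_mul, norm_sub_rev]
    exact mul_le_mul_of_nonneg_left hξ (by positivity)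
  rw [hsplit]
  refine (hPb _ (h3.trans hρ)).trans ?_
  gcongr

end KernelError

lemma exists_abs_splineKernel_sub_le {d k ℓ : ℕ} (hd : 0 < d) (hk : d < 2 * k)
    (hℓ : 2 * k - d < ℓ) {ε K Csg : ℝ} (hε : 2 * k < ε * ℓ) (hK : 0 < K) (hCsg : 0 < Csg) :
    ∃ C : ℝ, 0 < C ∧ ∀ (Ξ : Set (RSpace d)) (ρ : RSpace d → ℝ) (a : Ξ → RSpace d → ℝ),
      IsLocalDensity Ξ ρ a ℓ K → SlowGrowth ρ ε Csg → ∀ x α : RSpace d,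
        |splineKernel k a x α - surfaceSpline d k (x - α)| ≤
          C * ρ x ^ (2 * k - d) * (1 + ‖(ρ x)⁻¹ • (x - α)‖) ^ (-(d + (ε * ℓ - 2 * k))) := by
  have hℓ0 : (0 : ℝ) < ℓ := by exact_mod_cast (by omega : 0 < ℓ)
  have hε0 : 0 < ε := by
    have : (0 : ℝ) ≤ 2 * k := by positivity
    by_contra hcon
    nlinarith
  set p : ℝ := d + (ε * ℓ - 2 * k) with hp
  have hp0 : 0 < p := by
    have : (0 : ℝ) < d := by exact_mod_cast hd
    linarith
  obtain ⟨δ, hδ, C₁, hC₁, hexp⟩ := exists_surfaceSpline_expansion (k := k) hd (by omega : 0 < ℓ)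
  -- Threshold between near and far: beyond it slow growth gives `ρ α / ‖x - α‖ ≤ δ`. The 2 comes
  -- from `1 + s ≤ 2 * s`, hence `1 ≤ M`.
  obtain ⟨M, hM1, hM⟩ : ∃ M : ℝ, 1 ≤ M ∧ ∀ s, M ≤ s → 2 * Csg * (1 + s) ^ (-ε) ≤ δ := by
    have h1 : Tendsto (fun s : ℝ => 2 * Csg * (1 + s) ^ (-ε)) atTop (𝓝 (2 * Csg * 0)) :=
      ((tendsto_rpow_neg_atTop hε0).comp (tendsto_atTop_add_const_left _ 1 tendsto_id)).const_mul _
    rw [mul_zero] at h1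
    obtain ⟨M, hM⟩ := eventually_atTop.mp (h1.eventually_le_const hδ)
    exact ⟨max 1 M, le_max_left _ _, fun s hs => hM s ((le_max_right _ _).trans hs)⟩
  -- The absolute value covers `ε > 1`, where the slow growth exponent is negative.
  set N : ℝ := Csg * (1 + M) ^ |1 - ε| with hN
  obtain ⟨B, hB⟩ := (isCompact_closedBall (0 : RSpace d) (M + N)).exists_bound_of_continuousOn
    (continuous_surfaceSpline hk).continuousOn
  set B' := max B 0 with hB'
  have hB0 : 0 ≤ B' := le_max_right _ _
  have hBb : ∀ z : RSpace d, ‖z‖ ≤ M + N → |surfaceSpline d k z| ≤ B' := fun z hz =>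
    (hB z (by rwa [mem_closedBall_zero_iff])).trans (le_max_left _ _)
  set C₂ : ℝ := (K * B' + B') * (1 + M) ^ p with hC₂
  set C₃ : ℝ := K * (C₁ * (2 * Csg) ^ ℓ) with hC₃
  have hC₂0 : 0 ≤ C₂ := by positivity
  have hC₃0 : 0 < C₃ := by positivity
  refine ⟨C₂ + C₃, by positivity, fun Ξ ρ a h hsg x α => ?_⟩
  have hR := h.pos x
  set R := ρ x with hRdef
  set s := ‖R⁻¹ • (x - α)‖ with hs
  have hs0 : 0 ≤ s := norm_nonneg _
  have hs1 : ‖x - α‖ = s * R := by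
    rw [hs, norm_smul, Real.norm_of_nonneg (by positivity)]
    field_simp
  have hρα : ρ α ≤ Csg * R * (1 + s) ^ (1 - ε) := by
    have := hsg x α
    rwa [← hRdef, hs1, mul_div_cancel_right₀ _ hR.ne'] at this
  have hpow : 0 < (1 + s) ^ (-p) := by positivity
  rcases le_total s M with hsM | hsM
  · have h2 : ρ α ≤ N * R := by
      have h3 : (1 + s) ^ (1 - ε) ≤ (1 + M) ^ |1 - ε| :=
        (Real.rpow_le_rpow_of_exponent_le (by linarith) (le_abs_self _)).trans
          (Real.rpow_le_rpow (by linarith) (by linarith) (abs_nonneg _))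
      calc ρ α ≤ Csg * R * (1 + s) ^ (1 - ε) := hρα
        _ ≤ Csg * R * (1 + M) ^ |1 - ε| := by gcongr
        _ = N * R := by rw [hN]; ring
    refine (h.abs_splineKernel_sub_le_of_near hk hℓ hB0 hBb hR
      (by rw [hs1]; gcongr) h2).trans ?_
    have h4 : 1 ≤ (1 + M) ^ p * (1 + s) ^ (-p) := by
      rw [Real.rpow_neg (by positivity), ← div_eq_mul_inv, one_le_div (by positivity)]
      exact Real.rpow_le_rpow (by positivity) (by linarith) hp0.le
    calc R ^ (2 * k - d) * (K * B' + B')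
        ≤ R ^ (2 * k - d) * (K * B' + B') * ((1 + M) ^ p * (1 + s) ^ (-p)) :=
          le_mul_of_one_le_right (by positivity) h4
      _ = C₂ * R ^ (2 * k - d) * (1 + s) ^ (-p) := by rw [hC₂]; ring
      _ ≤ _ := by gcongr; linarith
  · have hs1' : 1 ≤ s := hM1.trans hsM
    have hspos : 0 < s := by linarith
    have hρs : ρ α / ‖x - α‖ ≤ 2 * Csg * (1 + s) ^ (-ε) := by
      rw [hs1, div_le_iff₀ (by positivity)]
      refine hρα.trans ?_
      rw [sub_eq_add_neg, Real.rpow_add (by positivity), Real.rpow_one]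
      calc Csg * R * ((1 + s) * (1 + s) ^ (-ε)) = Csg * R * (1 + s) ^ (-ε) * (1 + s) := by ring
        _ ≤ Csg * R * (1 + s) ^ (-ε) * (2 * s) := by gcongr; linarith
        _ = _ := by ring
    refine (h.abs_splineKernel_sub_le_of_far hk hℓ hC₁ hexp (by rw [hs1]; positivity)
      (hρs.trans (hM s hsM))).trans ?_
    have hρ0 := h.pos α
    have h5 : (1 + s) ^ (2 * k - d) * ((1 + s) ^ (-ε)) ^ ℓ = (1 + s) ^ (-p) := by
      rw [← Real.rpow_natCast, ← Real.rpow_natCast, ← Real.rpow_mul (by positivity),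
        ← Real.rpow_add (by positivity)]
      congr 1
      push_cast [Nat.cast_sub hk.le]
      rw [hp]
      ring
    calc ‖x - α‖ ^ (2 * k - d) * (K * (C₁ * (ρ α / ‖x - α‖) ^ ℓ))
        ≤ ((1 + s) * R) ^ (2 * k - d) * (K * (C₁ * (2 * Csg * (1 + s) ^ (-ε)) ^ ℓ)) := by
          gcongr
          · rw [hs1]; gcongr; linarith
      _ = C₃ * R ^ (2 * k - d) * ((1 + s) ^ (2 * k - d) * ((1 + s) ^ (-ε)) ^ ℓ) := by
          rw [hC₃, mul_pow, mul_pow]; ring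
      _ = C₃ * R ^ (2 * k - d) * (1 + s) ^ (-p) := by rw [h5]
      _ ≤ _ := by gcongr; linarith

/-! ### Integrating the kernel error -/

lemma integrable_and_integral_one_add_norm_rescaled {d : ℕ} {p R : ℝ} (hp : d < p) (hR : 0 < R)
    (x : RSpace d) :
    Integrable (fun α : RSpace d => (1 + ‖R⁻¹ • (x - α)‖) ^ (-p)) ∧
      ∫ α : RSpace d, (1 + ‖R⁻¹ • (x - α)‖) ^ (-p) =
        R ^ d * ∫ z : RSpace d, (1 + ‖z‖) ^ (-p) := by
  have hIint : Integrable fun z : RSpace d => (1 + ‖z‖) ^ (-p) :=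
    integrable_one_add_norm (by rwa [finrank_euclideanSpace_fin])
  refine ⟨(hIint.comp_smul (inv_ne_zero hR.ne')).comp_sub_left x, ?_⟩
  rw [integral_sub_left_eq_self (fun z : RSpace d => (1 + ‖R⁻¹ • z‖) ^ (-p)) volume x,
    Measure.integral_comp_inv_smul volume (fun z : RSpace d => (1 + ‖z‖) ^ (-p)) R,
    finrank_euclideanSpace_fin, abs_of_nonneg (by positivity), smul_eq_mul]

theorem theorem1 (d k ℓ : ℕ) (hd : 0 < d) (hk : d < 2 * k)
    (hℓ : (ℓ : ℤ) > 2 * (k : ℤ) - (d : ℤ) + 1)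
    (ε K Csg : ℝ) (hε : ε > 2 * (k : ℝ) / (ℓ : ℝ)) (hK : 0 < K) (hCsg : 0 < Csg) :
    ∃ C : ℝ, 0 < C ∧
      ∀ (Ξ : Set (RSpace d)) (ρ : RSpace d → ℝ) (a : Ξ → RSpace d → ℝ),
        IsLocalDensity Ξ ρ a ℓ K →
        (∀ x : RSpace d,
          MeasureTheory.AEStronglyMeasurable (splineKernel k a x) MeasureTheory.volume) →
        SlowGrowth ρ ε Csg →
        ∀ f : RSpace d → ℝ, ContDiff ℝ (2 * k : ℕ) f → HasCompactSupport f →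
          ∀ x : RSpace d,
            (∀ α : RSpace d, Summable (fun ξ : Ξ => a ξ α * surfaceSpline d k (x - ξ))) ∧
            MeasureTheory.Integrable
              (fun α => iteratedLaplacian k f α * splineKernel k a x α) MeasureTheory.volume ∧
            |f x - splineApproximant k a f x| ≤
              C * ρ x ^ (2 * k) * ⨆ y : RSpace d, |iteratedLaplacian k f y| := by
  have hℓ' : 2 * k - d < ℓ := by omega
  have hε' : 2 * k < ε * ℓ := by
    have hℓ0 : (0 : ℝ) < ℓ := by exact_mod_cast (by omega : 0 < ℓ)
    rwa [gt_iff_lt, div_lt_iff₀ hℓ0] at hε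
  obtain ⟨C, hC, hmain⟩ := exists_abs_splineKernel_sub_le hd hk hℓ' hε' hK hCsg
  set p : ℝ := d + (ε * ℓ - 2 * k) with hp
  set I : ℝ := ∫ z : RSpace d, (1 + ‖z‖) ^ (-p) with hI
  have hI0 : 0 ≤ I := integral_nonneg fun z => by positivity
  -- `I + 1` makes the constant positive knowing only `0 ≤ I`.
  refine ⟨C * (I + 1), by positivity, fun Ξ ρ a h hmeas hsg f hf hc x => ?_⟩
  have hR := h.pos x
  obtain ⟨hgc, hgs⟩ := iteratedLaplacian_regular k hf hc
  have hfund := integral_iteratedLaplacian_mul_surfaceSpline hd hk hf hc x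
  rw [splineApproximant]
  generalize iteratedLaplacian k f = g at *
  set S : ℝ := ⨆ y : RSpace d, |g y| with hS
  -- Boundedness is essential here: the real `⨆` of an unbounded family defaults to 0.
  have hgS : ∀ y, |g y| ≤ S := by
    obtain ⟨b, hb⟩ := hgs.exists_bound_of_continuous hgc
    exact fun y => le_ciSup (f := fun y => |g y|) ⟨b, by rintro _ ⟨y, rfl⟩; exact hb y⟩ y
  have hS0 : 0 ≤ S := (abs_nonneg _).trans (hgS 0)
  have hφc : Continuous fun α : RSpace d => surfaceSpline d k (x - α) :=
    (continuous_surfaceSpline hk).comp (by fun_prop)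
  have hφint : Integrable fun α => g α * surfaceSpline d k (x - α) :=
    (hgc.mul hφc).integrable_of_hasCompactSupport hgs.mul_right
  have hsummable := fun α => h.summable_mul_continuous α (g := fun ξ => surfaceSpline d k (x - ξ)) hφc
  set W : RSpace d → ℝ := fun α => S * (C * ρ x ^ (2 * k - d)) *
    (1 + ‖(ρ x)⁻¹ • (x - α)‖) ^ (-p) with hW
  obtain ⟨hTint, hTval⟩ := integrable_and_integral_one_add_norm_rescaled
    (by linarith : (d : ℝ) < p) hR x
  have hWint : Integrable W := hTint.const_mul _
  have hWval : ∫ α, W α = S * (C * ρ x ^ (2 * k)) * I := by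
    have : ρ x ^ (2 * k) = ρ x ^ (2 * k - d) * ρ x ^ d := by
      rw [← pow_add, Nat.sub_add_cancel hk.le]
    rw [hW, integral_const_mul, hTval, this]
    ring
  have hE : ∀ α, ‖g α * (splineKernel k a x α - surfaceSpline d k (x - α))‖ ≤ W α := by
    intro α
    simp only [hW]
    rw [norm_mul, Real.norm_eq_abs, Real.norm_eq_abs, mul_assoc S]
    exact mul_le_mul (hgS α) (hmain Ξ ρ a h hsg x α) (abs_nonneg _) hS0
  have hEint : Integrable fun α => g α * (splineKernel k a x α - surfaceSpline d k (x - α)) :=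
    hWint.mono' (hgc.aestronglyMeasurable.mul ((hmeas x).sub hφc.aestronglyMeasurable))
      (ae_of_all _ hE)
  have hsum : (fun α => g α * splineKernel k a x α) = fun α =>
      g α * (splineKernel k a x α - surfaceSpline d k (x - α)) +
        g α * surfaceSpline d k (x - α) := by
    funext α; ring
  refine ⟨hsummable, ?_, ?_⟩
  · rw [hsum]
    exact hEint.add hφint
  · have h1 : ∫ α, g α * splineKernel k a x α = (∫ α, g α *
        (splineKernel k a x α - surfaceSpline d k (x - α))) + f x := by
      rw [hsum, integral_add hEint hφint, hfund]
    rw [h1, abs_sub_comm, add_sub_cancel_right, ← Real.norm_eq_abs]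
    calc _ ≤ ∫ α, W α := norm_integral_le_of_norm_le hWint (ae_of_all _ hE)
      _ = C * I * ρ x ^ (2 * k) * S := by rw [hWval]; ring
      _ ≤ _ := by gcongr; linarith
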